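/- Let $k$ be a field, $R=k[x_1,\dots,x_n]$, $\mathfrak m=(x_1,\dots,x_n)$, and let $I\subseteq R$ be an ideal minimally generated by $q+1$ square-free monomials $m_0,\dots,m_q$, with projective dimension $\operatorname{pd}_R(I)=1$. An ideal $J\subseteq I$ is a reduction of $I$ if $JI^r=I^{r+1}$ for some integer $r\ge 0$; a minimal reduction is a reduction that is minimal under inclusion; the analytic spread $\ell(I)$ is the minimal number of generators of a minimal reduction of $I$; $\mu(I)$ is the minimal number of generators of $I$; and $\mathcal F(I)=R[It]/\mathfrak mR[It]$ is the fiber cone of $I$, where $R[It]=\bigoplus_{s\ge 0}I^st^s\subseteq R[t]$ is the Rees algebra. Then: 1. The only reduction of $I$ is $I$ itself. 2. The fiber cone is a polynomial ring over $k$ in $q+1$ variables; more precisely, there is an isomorphism of $k$-algebras $k[T_0,\dots,T_q]\to\mathcal F(I)$ sending $T_i$ to the class of $m_it$ for $i=0,\dots,q$. 3. $\ell(I)=\dim\mathcal F(I)=\mu(I)=q+1$. -/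

import Mathlib

open CategoryTheory

/-- `p` is a square-free monomial (with coefficient one): a product of distinct variables. -/
def IsSquarefreeMonomial {σ k : Type*} [CommSemiring k] (p : MvPolynomial σ k) : Prop :=
  ∃ s : Finset σ, p = ∏ j ∈ s, MvPolynomial.X j

/-- The family `m` generates the ideal `I`, and no proper subfamily of it does. -/
def IsMinimalGeneratingFamily {R ι : Type*} [CommRing R] (I : Ideal R) (m : ι → R) : Prop :=
  Ideal.span (Set.range m) = I ∧ ∀ s : Set ι, Ideal.span (m '' s) = I → s = Set.univ

/-- `J` is a reduction of `I`: `J ⊆ I` and `J I ^ r = I ^ (r + 1)` for some `r ≥ 0`. -/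
def IsReductionOf {R : Type*} [CommRing R] (J I : Ideal R) : Prop :=
  J ≤ I ∧ ∃ r : ℕ, J * I ^ r = I ^ (r + 1)

/-- `J` is a minimal reduction of `I`: it is minimal under inclusion among the reductions. -/
def IsMinimalReductionOf {R : Type*} [CommRing R] (J I : Ideal R) : Prop :=
  Minimal (fun K : Ideal R => IsReductionOf K I) J

/-- The analytic spread: the least number of generators of a minimal reduction of `I`
(for ideals of a Noetherian ring, so that all numbers of generators are finite). -/
noncomputable def analyticSpread {R : Type*} [CommRing R] (I : Ideal R) : ℕ :=
  sInf (Submodule.spanFinrank '' {J : Ideal R | IsMinimalReductionOf J I})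

/-- The fiber cone `R[It] / 𝔪 R[It]` of the ideal `I` of the polynomial ring
`R = k[x_j : j ∈ σ]`, where `𝔪` is the ideal generated by the variables. -/
abbrev FiberCone {σ k : Type*} [CommRing k] (I : Ideal (MvPolynomial σ k)) : Type _ :=
  reesAlgebra I ⧸
    (MvPolynomial.idealOfVars σ k).map (algebraMap (MvPolynomial σ k) (reesAlgebra I))

/-- The element `a t` of degree one of the Rees algebra `R[It]`, for `a ∈ I`. -/
noncomputable def reesDegreeOne {R : Type*} [CommRing R] {I : Ideal R} (a : R) (ha : a ∈ I) :
    reesAlgebra I :=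
  ⟨Polynomial.monomial 1 a, reesAlgebra.monomial_mem.mpr (by simpa using ha)⟩

/-- The class in the fiber cone of the element `a t` of the Rees algebra, for `a ∈ I`. -/
noncomputable def FiberCone.degreeOne {σ k : Type*} [CommRing k] {I : Ideal (MvPolynomial σ k)}
    (a : MvPolynomial σ k) (ha : a ∈ I) : FiberCone I :=
  Ideal.Quotient.mk _ (reesDegreeOne a ha)

/-- Every member of a minimal generating family belongs to the ideal. -/
theorem IsMinimalGeneratingFamily.mem {R ι : Type*} [CommRing R] {I : Ideal R} {m : ι → R}
    (h : IsMinimalGeneratingFamily I m) (i : ι) : m i ∈ I :=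
  h.1 ▸ Ideal.subset_span (Set.mem_range_self i)

/-! Projective dimension one makes `I` an ideal of linear type: all relations between the elements
`m_i t` of the Rees algebra follow from the linear ones. The three claims are consequences.

The syzygy module of the `m_i` is projective of rank at most `q`, and the Taylor syzygies generate
it, so at most `q` of them generate it locally at the origin. Read as edges between generators,
these join any `m_i` and `m_j` through divisors of their lcm
(`exists_edges_of_projectiveDimension_le_one`). A connected graph with so few edges is a tree, and
for each variable the generators not divisible by it are connected inside the tree. By
square-freeness, the exponent of a variable in a product counts the factors outside this connected
set. Hence two products of equally many generators, both dividing a monomial `M`, are linked by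
exchanging one factor at a time while still dividing `M` (`eq_of_invariant_under_moves`). Each
exchange is a linear relation.

So maps on `I` extend to the Rees algebra (`exists_reesAlgebra_lift`). Extending `I → I/N` for a
maximal submodule `N` containing a proper reduction gives a contradiction; extending the
coefficients at the generators inverts `k[T] → F(I)`. -/

/-! ### Rooted trees and exchange moves on exponent vectors -/

/-- A connected system of at most `|V| - 1` edges on `V` is a rooted tree: there are a parent map
and a depth function such that every edge joins a vertex to its parent. -/
theorem exists_parent_of_connected {V κ : Type*} [Fintype V] [Fintype κ] (e : κ → V × V)
    (root : V) (hcard : Fintype.card κ + 1 ≤ Fintype.card V)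
    (hconn : ∀ P : Set V, (∀ t, (e t).1 ∈ P ↔ (e t).2 ∈ P) → root ∈ P → ∀ v, v ∈ P) :
    ∃ (p : V → V) (d : V → ℕ), p root = root ∧ (∀ v, v ≠ root → d (p v) < d v) ∧
      ∀ t, (e t).1 = p (e t).2 ∨ (e t).2 = p (e t).1 := by
  classical
  let G : SimpleGraph V := SimpleGraph.fromRel fun x y => ∃ t, e t = (x, y)
  have hreach : ∀ v, G.Reachable root v := by
    refine hconn {v | G.Reachable root v} (fun t => ?_) (SimpleGraph.Reachable.refl _)
    by_cases h : (e t).1 = (e t).2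
    · rw [h]
    · have hadj : G.Adj (e t).1 (e t).2 := ⟨h, Or.inl ⟨t, rfl⟩⟩
      exact ⟨fun h => h.trans hadj.reachable, fun h => h.trans hadj.symm.reachable⟩
  -- The parent is the next vertex on a shortest walk to the root; the depth is the distance to the
  -- root.
  have hpar : ∀ v, ∃ w, (v = root → w = root) ∧
      (v ≠ root → G.dist root w < G.dist root v ∧ ∃ t, e t = (v, w) ∨ e t = (w, v)) := by
    intro v
    by_cases hv : v = root
    · exact ⟨root, fun _ => rfl, fun h => absurd hv h⟩
    obtain ⟨w, hw⟩ := (hreach v).symm.exists_walk_length_eq_dist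
    cases w with
    | nil => exact absurd rfl hv
    | @cons _ w _ h q =>
      refine ⟨w, fun h => absurd h hv, fun _ => ⟨?_, ?_⟩⟩
      · rw [SimpleGraph.dist_comm, SimpleGraph.dist_comm (u := root), ← hw]
        exact (SimpleGraph.dist_le q).trans_lt (by simp)
      · obtain ⟨-, ⟨t, ht⟩ | ⟨t, ht⟩⟩ := h
        · exact ⟨t, Or.inl ht⟩
        · exact ⟨t, Or.inr ht⟩
  choose p hroot hp using hpar
  refine ⟨p, G.dist root, hroot root rfl, fun v hv => (hp v hv).1, ?_⟩
  choose t ht using fun v : {v // v ≠ root} => (hp v.1 v.2).2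
  -- Distinct vertices sharing a parent edge would be each other's parents, each of smaller depth
  -- than the other.
  have hinj : Function.Injective t := by
    intro v w hvw
    have h1 := ht v
    have h2 := ht w
    have h3 := (hp v.1 v.2).1
    have h4 := (hp w.1 w.2).1
    rw [hvw] at h1
    apply Subtype.ext
    rcases h1 with h1 | h1 <;> rcases h2 with h2 | h2 <;> rw [h1, Prod.mk.injEq] at h2 <;>
      obtain ⟨h5, h6⟩ := h2
    · exact h5
    · rw [h6] at h3; rw [← h5] at h4; omega
    · rw [h5] at h3; rw [← h6] at h4; omega
    · exact h6
  -- The `|V| - 1` non-root vertices inject into at most `|V| - 1` edges, so every edge is a parent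
  -- edge.
  have hsurj : Function.Surjective t := by
    refine ((Fintype.bijective_iff_injective_and_card t).2 ⟨hinj, le_antisymm
      (Fintype.card_le_of_injective t hinj) ?_⟩).2
    rw [Fintype.card_subtype_compl, Fintype.card_subtype_eq]
    omega
  intro s
  obtain ⟨v, rfl⟩ := hsurj s
  rcases ht v with h | h <;> rw [h]
  · exact Or.inr rfl
  · exact Or.inl rfl

/-- If a vertex `v` of a connected set `S` in a rooted tree has its parent outside `S`,
then all other vertices of `S` are deeper than `v`. -/
theorem depth_lt_of_connected {V κ : Type*} (e : κ → V × V) {root : V}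
    {p : V → V} {d : V → ℕ} (hroot : p root = root) (hd : ∀ v, v ≠ root → d (p v) < d v)
    (he : ∀ t, (e t).1 = p (e t).2 ∨ (e t).2 = p (e t).1) {S : Set V} {v : V}
    (hpv : p v ∉ S) {x : V} (hxv : x ≠ v)
    (hconn : ∀ P : Set V, (∀ t, (e t).1 ∈ S → (e t).2 ∈ S → ((e t).1 ∈ P ↔ (e t).2 ∈ P)) →
      v ∈ P → x ∈ P) : d v < d x := by
  have key : ∀ (n : ℕ) (y : V), p^[n] y = v → y = v ∨ d v < d y := by
    intro n
    induction n with
    | zero => exact fun y hy => Or.inl hy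
    | succ n ih =>
      intro y hy
      rw [Function.iterate_succ_apply] at hy
      by_cases hyr : y = root
      · rw [hyr, hroot] at hy
        rw [hyr]
        exact ih root hy
      · rcases ih _ hy with h | h
        · exact Or.inr (h ▸ hd y hyr)
        · exact Or.inr (h.trans (hd y hyr))
  -- The only edge leaving the set of descendants of `v` goes to `p v`, which is outside `S`; within
  -- `S`, being a descendant of `v` is therefore preserved along edges.
  have step : ∀ y z, z ∈ S → z = p y → ((∃ n, p^[n] z = v) ↔ ∃ n, p^[n] y = v) := by
    rintro y z hz rfl
    constructor
    · rintro ⟨n, hn⟩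
      exact ⟨n + 1, hn⟩
    · rintro ⟨n, hn⟩
      cases n with
      | zero =>
        have : y = v := hn
        exact absurd (this ▸ hz) hpv
      | succ n => exact ⟨n, hn⟩
  obtain ⟨n, hn⟩ : x ∈ {y | ∃ n, p^[n] y = v} := by
    refine hconn _ (fun t h1 h2 => ?_) ⟨0, rfl⟩
    rcases he t with h | h
    · exact step _ _ h1 h
    · exact (step _ _ h2 h).symm
  exact (key n x hn).resolve_left hxv

/-- Two exponent vectors of the same total degree whose weights along the sets `A j` are bounded by
`M j` are linked by moves of one unit from a vertex to another one that preserve the bounds,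
provided that the complements of the sets `A j` are connected in a rooted tree. -/
theorem eq_of_invariant_under_moves {V J X : Type*} [Fintype V] [DecidableEq V] {root : V}
    {p : V → V} {d : V → ℕ} (hd : ∀ v, v ≠ root → d (p v) < d v)
    (A : J → Finset V)
    (hA : ∀ j v x, v ≠ root → v ∉ A j → p v ∈ A j → x ∉ A j → x ≠ v → d v < d x)
    (M : J → ℕ) (Φ : (V →₀ ℕ) → X)
    (hΦ : ∀ (a : V →₀ ℕ) (v w : V),
      (∀ j, ∑ i ∈ A j, (a + Finsupp.single v 1 : V →₀ ℕ) i ≤ M j) →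
      (∀ j, ∑ i ∈ A j, (a + Finsupp.single w 1 : V →₀ ℕ) i ≤ M j) →
      Φ (a + Finsupp.single v 1) = Φ (a + Finsupp.single w 1))
    (a b : V →₀ ℕ) (hab : ∑ i, a i = ∑ i, b i)
    (ha : ∀ j, ∑ i ∈ A j, a i ≤ M j) (hb : ∀ j, ∑ i ∈ A j, b i ≤ M j) : Φ a = Φ b := by
  have hmin : ∀ x, d root ≤ d x := by
    intro x
    induction hx : d x using Nat.strong_induction_on generalizing x with
    | _ D ihx =>
    by_cases hxr : x = root
    · exact (hxr ▸ hx).le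
    · have := hd x hxr
      have := ihx _ (hx ▸ this) (p x) rfl
      omega
  have hsum : ∀ (f : V → ℕ) (a : V →₀ ℕ) (v : V) (s : Finset V),
      ∑ i ∈ s, f i * (a + Finsupp.single v 1 : V →₀ ℕ) i =
        ∑ i ∈ s, f i * a i + if v ∈ s then f v else 0 := by
    intro f a v s
    simp [mul_add, Finset.sum_add_distrib, Finsupp.single_apply]
  have hsum1 : ∀ (a : V →₀ ℕ) (v : V) (s : Finset V),
      ∑ i ∈ s, (a + Finsupp.single v 1 : V →₀ ℕ) i =
        ∑ i ∈ s, a i + if v ∈ s then 1 else 0 := by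
    intro a v s
    simpa using hsum (fun _ => 1) a v s
  -- Moving a unit to a parent lowers the total depth of the two vectors. The move is made at a
  -- deepest non-root vertex where they differ, in the vector that is larger there.
  induction hN : ∑ i, d i * (a i + b i) using Nat.strong_induction_on generalizing a b with
  | _ N ih =>
  by_cases hne : (Finset.univ.filter fun v => v ≠ root ∧ a v ≠ b v).Nonempty
  · obtain ⟨v, hv, hmax⟩ := Finset.exists_max_image _ d hne
    simp only [Finset.mem_filter, Finset.mem_univ, true_and] at hv hmax
    wlog hlt : b v < a v generalizing a b
    · refine (this b a hab.symm hb ha ?_ ?_ ⟨hv.1, hv.2.symm⟩ ?_ ?_).symm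
      · rw [← hN]
        exact Finset.sum_congr rfl fun i _ => by rw [add_comm]
      · simpa only [ne_comm] using hne
      · exact fun x hx => hmax x ⟨hx.1, hx.2.symm⟩
      · exact lt_of_le_of_ne (not_lt.1 hlt) hv.2
    obtain ⟨a, rfl⟩ : ∃ a', a = a' + Finsupp.single v 1 :=
      ⟨a - Finsupp.single v 1, (tsub_add_cancel_of_le (by
        rw [Finsupp.single_le_iff]; omega)).symm⟩
    have hdeep : ∀ x, d v < d x → (a + Finsupp.single v 1 : V →₀ ℕ) x = b x := by
      intro x hx
      by_contra h
      by_cases hxr : x = root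
      · exact absurd (hmin v) (not_le.2 (hxr ▸ hx))
      · exact absurd (hmax x ⟨hxr, h⟩) (not_le.2 hx)
    have ha' : ∀ j, ∑ i ∈ A j, (a + Finsupp.single (p v) 1 : V →₀ ℕ) i ≤ M j := by
      intro j
      have h1 := ha j
      rw [hsum1] at h1 ⊢
      by_cases h2 : v ∈ A j
      · rw [if_pos h2] at h1
        split_ifs <;> omega
      by_cases h3 : p v ∈ A j
      · rw [if_pos h3]
        -- The only case where the bound could fail. Off `A j`, every vertex other than `v` is
        -- deeper, where `a` and `b` agree; so `a` weighs more than `b` off `A j`, hence less on it,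
        -- leaving room for one unit.
        have h4 : ∑ i ∈ (A j)ᶜ, b i < ∑ i ∈ (A j)ᶜ, (a + Finsupp.single v 1 : V →₀ ℕ) i := by
          refine Finset.sum_lt_sum (fun x hx => ?_) ⟨v, Finset.mem_compl.2 h2, hlt⟩
          by_cases hxv : x = v
          · exact hxv ▸ hlt.le
          · exact (hdeep x (hA j v x hv.1 h2 h3 (Finset.mem_compl.1 hx) hxv)).ge
        rw [← Finset.sum_add_sum_compl (A j), ← Finset.sum_add_sum_compl (A j) b,
          hsum1 a v (A j), if_neg h2] at hab
        have h5 := hb j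
        omega
      · rw [if_neg h3]
        rw [if_neg h2] at h1
        exact h1
    rw [hΦ a v (p v) ha ha']
    refine ih _ ?_ _ b ?_ ha' hb rfl
    · rw [← hN]
      simp only [mul_add, Finset.sum_add_distrib, hsum, Finset.mem_univ, if_true]
      have := hd v hv.1
      omega
    · rw [← hab, hsum1, hsum1]
      simp
  · have hne' : ∀ v, v ≠ root → a v = b v := by
      intro v hv
      by_contra h
      exact hne ⟨v, by simp [hv, h]⟩
    congr 1
    ext v
    by_cases hv : v = root
    · have h : ∑ x ∈ Finset.univ.erase v, a x = ∑ x ∈ Finset.univ.erase v, b x :=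
        Finset.sum_congr rfl fun x hx => hne' x (hv ▸ Finset.ne_of_mem_erase hx)
      have h1 := Finset.add_sum_erase _ (fun i => a i) (Finset.mem_univ v)
      have h2 := Finset.add_sum_erase _ (fun i => b i) (Finset.mem_univ v)
      omega
    · exact hne' v hv

/-! ### Syzygies of monomials in projective dimension one -/

/-- The kernel of a surjection from a projective module onto a module of projective dimension
at most one is projective. -/
theorem projective_ker_of_projectiveDimension_le_one.{u} {R F N : Type u} [CommRing R]
    [AddCommGroup F] [Module R F] [Module.Projective R F] [AddCommGroup N] [Module R N]
    (f : F →ₗ[R] N) (hf : Function.Surjective f)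
    (hpd : projectiveDimension (ModuleCat.of R N) ≤ 1) :
    Module.Projective R (LinearMap.ker f) := by
  have hexact : Function.Exact (LinearMap.ker f).subtype f := LinearMap.exact_subtype_ker_map f
  have hS := ModuleCat.shortComplex_shortExact
    (ModuleCat.shortComplexOfCompEqZero _ _ hexact.linearMap_comp_eq_zero) hexact
    (Submodule.injective_subtype _) hf
  rw [IsProjective.iff_projective]
  have h3 : HasProjectiveDimensionLE (ModuleCat.of R N) 1 :=
    (projectiveDimension_le_iff _ 1).1 (by exact_mod_cast hpd)
  have h2 : Projective (ModuleCat.of R F) := (IsProjective.iff_projective F).1 inferInstance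
  rw [projective_iff_hasProjectiveDimensionLT_one]
  exact (hS.hasProjectiveDimensionLT_X₃_iff 0 h2).1 h3

open TensorProduct in
/-- A generating family of a finite projective module over a domain contains a subfamily, indexed
by as many elements as the rank, that generates locally at a given prime. -/
theorem exists_subfamily_locally_spanning.{v} {R K : Type*} {ι : Type v} [CommRing R] [IsDomain R]
    [AddCommGroup K] [Module R K] [Module.Finite R K] [Module.Projective R K]
    (p : Ideal R) [p.IsPrime] (g : ι → K) (hg : Submodule.span R (Set.range g) = ⊤) :
    ∃ (κ : Type v) (_ : Fintype κ) (a : κ → ι), Fintype.card κ ≤ Module.finrank R K ∧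
      ∀ x : K, ∃ r, r ∉ p ∧ r • x ∈ Submodule.span R (Set.range (g ∘ a)) := by
  obtain ⟨κ, a, -, hspan, hli⟩ := exists_linearIndependent' p.ResidueField
    (fun i => (1 : p.ResidueField) ⊗ₜ[R] g i)
  have : Finite κ := hli.finite
  have : Fintype κ := Fintype.ofFinite κ
  refine ⟨κ, this, a, ?_, ?_⟩
  · rw [← Ideal.finrank_fiber_eq_finrank p]
    exact hli.fintype_card_le_finrank
  have htop : Submodule.span p.ResidueField
      (Set.range fun i => (1 : p.ResidueField) ⊗ₜ[R] g i) = ⊤ := by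
    have h := Submodule.baseChange_span (R := R) (M := K) p.ResidueField (Set.range g)
    rw [hg, Submodule.baseChange_top, ← Set.range_comp] at h
    exact h.symm
  let N := Submodule.span R (Set.range (g ∘ a))
  -- Nakayama's lemma: the fiber of `K ⧸ N` at `p` vanishes, so `p` is not in its support.
  have hsub : Subsingleton (p.ResidueField ⊗[R] (K ⧸ N)) := by
    have hsurj : Function.Surjective (N.mkQ.baseChange p.ResidueField) :=
      LinearMap.lTensor_surjective _ N.mkQ_surjective
    have hzero : N.mkQ.baseChange p.ResidueField = 0 := by
      rw [← LinearMap.ker_eq_top, ← top_le_iff, ← htop, ← hspan, Submodule.span_le]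
      rintro _ ⟨t, rfl⟩
      have : N.mkQ (g (a t)) = 0 := by
        rw [Submodule.mkQ_apply, Submodule.Quotient.mk_eq_zero]
        exact Submodule.subset_span ⟨t, rfl⟩
      simp [this]
    refine ⟨fun x y => ?_⟩
    obtain ⟨x, rfl⟩ := hsurj x
    obtain ⟨y, rfl⟩ := hsurj y
    simp [hzero]
  intro x
  have hsupp : (⟨p, inferInstance⟩ : PrimeSpectrum R) ∉ Module.support R (K ⧸ N) := by
    rw [Module.mem_support_iff_nontrivial_residueField_tensorProduct,
      not_nontrivial_iff_subsingleton]
    exact hsub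
  obtain ⟨r, hr, hx⟩ := Module.notMem_support_iff'.1 hsupp (N.mkQ x)
  refine ⟨r, hr, ?_⟩
  rwa [← map_smul, Submodule.mkQ_apply, Submodule.Quotient.mk_eq_zero] at hx

/-- Over a domain, the kernel of a surjection from `R ^ ι` onto a nonzero ideal has rank less than
the number of elements of `ι`. -/
theorem finrank_ker_add_one_le {R ι : Type*} [CommRing R] [IsDomain R] [Fintype ι] {I : Ideal R}
    (hI : I ≠ ⊥) (f : (ι → R) →ₗ[R] I) (hf : Function.Surjective f) :
    Module.finrank R (LinearMap.ker f) + 1 ≤ Fintype.card ι := by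
  have h := Submodule.finrank_quotient_add_finrank (LinearMap.ker f)
  rw [(f.quotKerEquivOfSurjective hf).finrank_eq, Module.finrank_pi] at h
  have : Module.Finite R I := Module.Finite.of_surjective f hf
  have : Nontrivial I := Submodule.nontrivial_iff_ne_bot.2 hI
  have := Module.finrank_pos (R := R) (M := I)
  omega

theorem Finsupp.tsub_add_eq_sup_nat {σ : Type*} (u w : σ →₀ ℕ) : u - w + w = u ⊔ w := by
  ext j
  simp only [Finsupp.add_apply, Finsupp.tsub_apply, Finsupp.sup_apply]
  omega

/-- The Taylor syzygy of two monomials `x ^ χ i` and `x ^ χ j`. -/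
noncomputable def taylorSyzygy {k σ V : Type*} [CommRing k] [DecidableEq V] (χ : V → σ →₀ ℕ)
    (t : V × V) : V → MvPolynomial σ k :=
  Pi.single t.1 (MvPolynomial.monomial (χ t.2 - χ t.1) 1) -
    Pi.single t.2 (MvPolynomial.monomial (χ t.1 - χ t.2) 1)

theorem linearCombination_taylorSyzygy {k σ V : Type*} [CommRing k] [Fintype V] [DecidableEq V]
    (χ : V → σ →₀ ℕ) (t : V × V) :
    Fintype.linearCombination (MvPolynomial σ k)
      (fun i => MvPolynomial.monomial (χ i) (1 : k)) (taylorSyzygy χ t) = 0 := by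
  simp only [taylorSyzygy, map_sub, Fintype.linearCombination_apply_single, smul_eq_mul,
    MvPolynomial.monomial_mul, Finsupp.tsub_add_eq_sup_nat, sup_comm (χ t.1), sub_self]

/-- The Taylor syzygies generate the module of syzygies of a family of monomials. -/
theorem span_taylorSyzygy {k σ V : Type*} [CommRing k] [Fintype V] [DecidableEq V]
    (χ : V → σ →₀ ℕ) :
    Submodule.span (MvPolynomial σ k) (Set.range (taylorSyzygy (k := k) χ)) =
      LinearMap.ker (Fintype.linearCombination (MvPolynomial σ k)
        (fun i => MvPolynomial.monomial (χ i) (1 : k))) := by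
  classical
  refine le_antisymm (Submodule.span_le.2 ?_) fun v hv => ?_
  · rintro _ ⟨t, rfl⟩
    exact linearCombination_taylorSyzygy χ t
  set T := Submodule.span (MvPolynomial σ k) (Set.range (taylorSyzygy (k := k) χ))
  set f := Fintype.linearCombination (MvPolynomial σ k)
        (fun i => MvPolynomial.monomial (χ i) (1 : k))
  -- A `k`-linear section candidate: each monomial divisible by some generator is lifted through one
  -- chosen such generator. Modulo `T` the choice is immaterial, so `N ∘ f` is the identity there
  -- and syzygies vanish.
  let N : MvPolynomial σ k →ₗ[k] (V → MvPolynomial σ k) :=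
    (MvPolynomial.basisMonomials σ k).constr k fun u =>
      if h : ∃ i, χ i ≤ u then Pi.single h.choose (MvPolynomial.monomial (u - χ h.choose) 1) else 0
  have hN : ∀ u, N (MvPolynomial.monomial u 1) = if h : ∃ i, χ i ≤ u then
      Pi.single h.choose (MvPolynomial.monomial (u - χ h.choose) 1) else 0 := by
    intro u
    have h := congrFun (MvPolynomial.coe_basisMonomials σ k) u
    rw [← h, Module.Basis.constr_basis]
  have key : (T.mkQ.restrictScalars k).comp (N.comp (f.restrictScalars k)) =
      T.mkQ.restrictScalars k := by
    refine LinearMap.pi_ext' fun i => MvPolynomial.linearMap_ext fun w => LinearMap.ext_ring ?_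
    simp only [LinearMap.comp_apply, LinearMap.coe_single, LinearMap.restrictScalars_apply, f,
      Fintype.linearCombination_apply_single, smul_eq_mul, MvPolynomial.monomial_mul, mul_one, hN]
    have h : ∃ j, χ j ≤ w + χ i := ⟨i, le_add_self⟩
    rw [dif_pos h]
    generalize hj : h.choose = j
    have hle : χ j ≤ w + χ i := hj ▸ h.choose_spec
    rw [← sub_eq_zero, ← map_sub, Submodule.mkQ_apply, Submodule.Quotient.mk_eq_zero]
    have hmem : MvPolynomial.monomial (w + χ i - χ i ⊔ χ j) (1 : k) • taylorSyzygy (k := k) χ (j, i)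
        ∈ T := Submodule.smul_mem _ _ (Submodule.subset_span ⟨_, rfl⟩)
    convert hmem using 1
    simp only [taylorSyzygy, smul_sub, ← Pi.single_smul, smul_eq_mul, MvPolynomial.monomial_mul,
      mul_one]
    congr 4
    · ext l
      have := hle l
      simp only [Finsupp.add_apply, Finsupp.tsub_apply, Finsupp.sup_apply] at this ⊢
      omega
    · ext l
      have := hle l
      simp only [Finsupp.add_apply, Finsupp.tsub_apply, Finsupp.sup_apply] at this ⊢
      omega
  have h := LinearMap.congr_fun key v
  simp only [LinearMap.comp_apply, LinearMap.restrictScalars_apply,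
    LinearMap.mem_ker.1 hv, map_zero] at h
  exact (Submodule.Quotient.mk_eq_zero _).1 h.symm

/-- For a monomial ideal of projective dimension at most one, there is a set of fewer than `|V|`
edges on the set `V` of generators such that any two generators are connected by edges between
divisors of their least common multiple. -/
theorem exists_edges_of_projectiveDimension_le_one {k : Type*} [Field k] {σ V : Type} [Finite σ]
    [Fintype V] [Nonempty V] (χ : V → σ →₀ ℕ) (I : Ideal (MvPolynomial σ k))
    (hI : Ideal.span (Set.range fun i => MvPolynomial.monomial (χ i) (1 : k)) = I)
    (hpd : projectiveDimension (ModuleCat.of (MvPolynomial σ k) I) ≤ 1) :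
    ∃ (κ : Type) (_ : Fintype κ) (e : κ → V × V), Fintype.card κ + 1 ≤ Fintype.card V ∧
      ∀ (i j : V) (P : Set V), (∀ t, χ (e t).1 ≤ χ i ⊔ χ j → χ (e t).2 ≤ χ i ⊔ χ j →
        ((e t).1 ∈ P ↔ (e t).2 ∈ P)) → i ∈ P → j ∈ P := by
  classical
  let m : V → MvPolynomial σ k := fun i => MvPolynomial.monomial (χ i) 1
  have hrange : LinearMap.range (Fintype.linearCombination (MvPolynomial σ k) m) = I := by
    rw [Fintype.range_linearCombination, ← hI]
  let f : (V → MvPolynomial σ k) →ₗ[MvPolynomial σ k] I :=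
    (Fintype.linearCombination (MvPolynomial σ k) m).codRestrict I
      fun v => hrange ▸ LinearMap.mem_range_self _ v
  have hf : Function.Surjective f := by
    rintro ⟨x, hx⟩
    rw [← hrange] at hx
    obtain ⟨v, hv⟩ := hx
    exact ⟨v, Subtype.ext hv⟩
  have hker : LinearMap.ker f = LinearMap.ker (Fintype.linearCombination (MvPolynomial σ k) m) :=
    LinearMap.ker_codRestrict _ _ _
  have hproj := projective_ker_of_projectiveDimension_le_one f hf hpd
  have hbot : I ≠ ⊥ := by
    obtain ⟨i⟩ := ‹Nonempty V›
    intro h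
    have : m i ∈ I := hI ▸ Ideal.subset_span ⟨i, rfl⟩
    rw [h, Ideal.mem_bot, MvPolynomial.monomial_eq_zero] at this
    exact one_ne_zero this
  let g : V × V → LinearMap.ker f := fun t =>
    ⟨taylorSyzygy χ t, hker ▸ linearCombination_taylorSyzygy χ t⟩
  have hg : Submodule.span (MvPolynomial σ k) (Set.range g) = ⊤ := by
    apply Submodule.map_injective_of_injective (LinearMap.ker f).injective_subtype
    rw [Submodule.map_span, ← Set.range_comp, Submodule.map_top, Submodule.range_subtype]
    exact (span_taylorSyzygy χ).trans hker.symm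
  have hprime := RingHom.ker_isPrime (MvPolynomial.constantCoeff : MvPolynomial σ k →+* k)
  obtain ⟨κ, hκ, e, hcard, he⟩ := exists_subfamily_locally_spanning
    (RingHom.ker (MvPolynomial.constantCoeff : MvPolynomial σ k →+* k)) g hg
  refine ⟨κ, hκ, e, (Nat.succ_le_succ hcard).trans (finrank_ker_add_one_le hbot f hf), ?_⟩
  intro i j P hP hi
  obtain ⟨r, hr, hmem⟩ := he (g (i, j))
  obtain ⟨c, hc⟩ := (Submodule.mem_span_range_iff_exists_fun _).1 hmem
  set u := χ i ⊔ χ j with hu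
  -- The part of the degree-`u` coefficient of `∑ v_l m_l` coming from `l ∈ P`. The two ends of a
  -- Taylor syzygy contribute opposite values, so it detects only edges crossing the boundary of `P`
  -- whose lcm divides `x ^ u`.
  let Ψ : (V → MvPolynomial σ k) →ₗ[k] k :=
    ∑ l ∈ Finset.univ.filter (· ∈ P), (MvPolynomial.lcoeff k u).comp
      ((LinearMap.mulRight k (m l)).comp (LinearMap.proj l))
  have hΨ : ∀ (b : MvPolynomial σ k) (t : V × V), Ψ (b • taylorSyzygy χ t) =
      (if t.1 ∈ P then b * MvPolynomial.monomial (χ t.1 ⊔ χ t.2) 1 else 0).coeff u -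
      (if t.2 ∈ P then b * MvPolynomial.monomial (χ t.1 ⊔ χ t.2) 1 else 0).coeff u := by
    intro b t
    have hs : ∀ (l : V) (a : MvPolynomial σ k), Ψ (Pi.single l a) =
        (if l ∈ P then a * m l else 0).coeff u := by
      intro l a
      simp only [Ψ, LinearMap.sum_apply, LinearMap.comp_apply, LinearMap.proj_apply,
        LinearMap.mulRight_apply, MvPolynomial.lcoeff_apply]
      by_cases hl : l ∈ P
      · rw [Finset.sum_eq_single_of_mem l (by simpa using hl), Pi.single_eq_same, if_pos hl]
        intro x _ hx
        rw [Pi.single_eq_of_ne hx, zero_mul, MvPolynomial.coeff_zero]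
      · rw [if_neg hl, MvPolynomial.coeff_zero]
        refine Finset.sum_eq_zero fun x hx => ?_
        have hxl : x ≠ l := by
          rintro rfl
          exact hl (Finset.mem_filter.1 hx).2
        rw [Pi.single_eq_of_ne hxl, zero_mul, MvPolynomial.coeff_zero]
    simp only [taylorSyzygy, smul_sub, ← Pi.single_smul, map_sub, hs, m, smul_eq_mul, mul_assoc,
      MvPolynomial.monomial_mul, Finsupp.tsub_add_eq_sup_nat, mul_one, sup_comm (χ t.2)]
  have h0 : Ψ (r • taylorSyzygy χ (i, j)) = 0 := by
    have := congrArg Subtype.val hc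
    simp only [g, Function.comp_apply, Submodule.coe_sum, Submodule.coe_smul] at this
    rw [← this, map_sum]
    refine Finset.sum_eq_zero fun t _ => ?_
    rw [hΨ]
    by_cases h : χ (e t).1 ⊔ χ (e t).2 ≤ u
    · simp only [hP t (le_sup_left.trans h) (le_sup_right.trans h), sub_self]
    · have hz : (c t * MvPolynomial.monomial (χ (e t).1 ⊔ χ (e t).2) 1).coeff u = 0 := by
        rw [MvPolynomial.coeff_mul_monomial', if_neg h]
      split_ifs <;> simp [hz]
  rw [hΨ, ← hu] at h0
  -- If `j ∉ P`, then `Ψ` takes the constant term of `r` as its value on `r` times the syzygy of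
  -- `(i, j)`; this is nonzero as `r` lies outside the ideal of the origin.
  by_contra hj
  rw [if_pos hi, if_neg hj, MvPolynomial.coeff_mul_monomial', if_pos le_rfl] at h0
  apply hr
  rw [RingHom.mem_ker, MvPolynomial.constantCoeff_eq]
  simpa using h0

/-! ### From the tree to linear type -/

/-- The exponent of the monomial `∏ i, (x ^ χ i) ^ a i`. -/
noncomputable def totalExponent {σ V : Type*} [Fintype V] (χ : V → σ →₀ ℕ) (a : V →₀ ℕ) : σ →₀ ℕ :=
  ∑ i, a i • χ i

theorem totalExponent_add_single {σ V : Type*} [Fintype V] [DecidableEq V] (χ : V → σ →₀ ℕ)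
    (a : V →₀ ℕ) (v : V) :
    totalExponent χ (a + Finsupp.single v 1) = totalExponent χ a + χ v := by
  simp only [totalExponent, Finsupp.add_apply, add_smul, Finset.sum_add_distrib]
  congr 1
  rw [Finset.sum_eq_single_of_mem v (Finset.mem_univ v)]
  · simp
  · intro w _ hw
    rw [Finsupp.single_eq_of_ne hw, zero_smul]

/-- If square-free monomials are connected by few enough edges compatible with divisibility, then
every function on exponent vectors that is invariant under exchanging two factors is determined by
the total degree on the vectors whose monomial divides a given one. -/
theorem eq_of_invariant_under_exchange {σ V κ X : Type*} [Fintype V] [Nonempty V] [Fintype κ]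
    (χ : V → σ →₀ ℕ) (hχ : ∀ i j, χ i j ≤ 1) (e : κ → V × V)
    (hcard : Fintype.card κ + 1 ≤ Fintype.card V)
    (he : ∀ (i j : V) (P : Set V), (∀ t, χ (e t).1 ≤ χ i ⊔ χ j → χ (e t).2 ≤ χ i ⊔ χ j →
        ((e t).1 ∈ P ↔ (e t).2 ∈ P)) → i ∈ P → j ∈ P)
    (M : σ →₀ ℕ) (Φ : (V →₀ ℕ) → X)
    (hΦ : ∀ (a : V →₀ ℕ) (v w : V), totalExponent χ a + χ v ≤ M → totalExponent χ a + χ w ≤ M →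
      Φ (a + Finsupp.single v 1) = Φ (a + Finsupp.single w 1))
    (a b : V →₀ ℕ) (hab : ∑ i, a i = ∑ i, b i)
    (ha : totalExponent χ a ≤ M) (hb : totalExponent χ b ≤ M) : Φ a = Φ b := by
  classical
  obtain ⟨root⟩ := ‹Nonempty V›
  obtain ⟨p, d, hroot, hd, hp⟩ := exists_parent_of_connected e root hcard
    fun P hP hr v => he root v P (fun t _ _ => hP t) hr
  let A : σ → Finset V := fun j => Finset.univ.filter fun i => χ i j ≠ 0
  have hsum : ∀ (c : V →₀ ℕ) (j : σ), ∑ i ∈ A j, c i = totalExponent χ c j := by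
    intro c j
    simp only [A, totalExponent, Finsupp.finsetSum_apply, Finsupp.smul_apply, smul_eq_mul,
      Finset.sum_filter]
    refine Finset.sum_congr rfl fun i _ => ?_
    have := hχ i j
    split_ifs with h
    · rw [show χ i j = 1 by omega, mul_one]
    · rw [not_not.1 h, mul_zero]
  have hle : ∀ c : V →₀ ℕ, (∀ j, ∑ i ∈ A j, c i ≤ M j) ↔ totalExponent χ c ≤ M := fun c =>
    forall_congr' fun j => by rw [hsum]
  refine eq_of_invariant_under_moves hd A ?_ M Φ ?_ a b hab ((hle a).2 ha) ((hle b).2 hb)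
  · intro j v x _ hv hpv hx hxv
    simp only [A, Finset.mem_filter, Finset.mem_univ, true_and, not_not] at hv hpv hx
    refine depth_lt_of_connected (S := {i | χ i j = 0}) e hroot hd hp hpv hxv fun P hP hvP => ?_
    -- Divisors of the lcm of two monomials free of `x_j` are free of `x_j`, so the connecting edges
    -- stay inside `S`.
    have hS : ∀ i, χ i ≤ χ v ⊔ χ x → χ i j = 0 := fun i hi => by
      have := hi j
      rw [Finsupp.sup_apply, hv, hx] at this
      simpa using this
    exact he v x P (fun t h1 h2 => hP t (hS _ h1) (hS _ h2)) hvP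
  · intro a v w h1 h2
    rw [hle, totalExponent_add_single] at h1 h2
    exact hΦ a v w h1 h2

/-- The polynomial relations between the elements `x ^ χ i * t` of a Rees algebra follow from the
linear ones. -/
theorem eval₂Hom_eq_zero_of_linear_relations {k σ V κ B : Type*} [Field k] [CommRing B] [Algebra k B]
    [Fintype V] [Nonempty V] [Fintype κ]
    (χ : V → σ →₀ ℕ) (hχ : ∀ i j, χ i j ≤ 1) (e : κ → V × V)
    (hcard : Fintype.card κ + 1 ≤ Fintype.card V)
    (he : ∀ (i j : V) (P : Set V), (∀ t, χ (e t).1 ≤ χ i ⊔ χ j → χ (e t).2 ≤ χ i ⊔ χ j →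
        ((e t).1 ∈ P ↔ (e t).2 ∈ P)) → i ∈ P → j ∈ P)
    (ρ : MvPolynomial σ k →ₐ[k] B) (β : V → B)
    (hβ : ∀ v w, ρ (MvPolynomial.monomial (χ w - χ v) 1) * β v =
      ρ (MvPolynomial.monomial (χ v - χ w) 1) * β w)
    (F : MvPolynomial V (MvPolynomial σ k))
    (hF : MvPolynomial.eval₂Hom (Polynomial.C : MvPolynomial σ k →+* _)
      (fun i => Polynomial.monomial 1 (MvPolynomial.monomial (χ i) (1 : k))) F = 0) :
    MvPolynomial.eval₂Hom (ρ : MvPolynomial σ k →+* B) β F = 0 := by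
  classical
  let h : (V →₀ ℕ) → (σ →₀ ℕ) → B := fun a u => ρ (MvPolynomial.monomial u 1) * ∏ i, β i ^ a i
  have hh : ∀ (M : σ →₀ ℕ) (a b : V →₀ ℕ), ∑ i, a i = ∑ i, b i → totalExponent χ a ≤ M →
      totalExponent χ b ≤ M → h a (M - totalExponent χ a) = h b (M - totalExponent χ b) := by
    intro M a b hab ha hb
    refine eq_of_invariant_under_exchange χ hχ e hcard he M (fun a => h a (M - totalExponent χ a))
      ?_ a b hab ha hb
    intro a v w hv hw
    have hprod : ∀ x : V, ∏ i, β i ^ (a + Finsupp.single x 1 : V →₀ ℕ) i =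
        β x * ∏ i, β i ^ a i := by
      intro x
      simp only [Finsupp.add_apply, pow_add, Finset.prod_mul_distrib]
      rw [mul_comm]
      congr 1
      rw [Finset.prod_eq_single_of_mem x (Finset.mem_univ x)]
      · rw [Finsupp.single_eq_same, pow_one]
      · intro y _ hy
        rw [Finsupp.single_eq_of_ne hy, pow_zero]
    -- Splitting off the cofactor of the generator of `x` in its lcm with that of `y` exposes one
    -- side of the linear relation `hβ`.
    have hsplit : ∀ x y : V, totalExponent χ a + χ x ≤ M → totalExponent χ a + χ y ≤ M →
        M - (totalExponent χ a + χ x) = (M - (totalExponent χ a + χ x ⊔ χ y)) + (χ y - χ x) := by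
      intro x y hx hy
      ext l
      have h1 := hx l
      have h2 := hy l
      simp only [Finsupp.add_apply, Finsupp.tsub_apply, Finsupp.sup_apply] at h1 h2 ⊢
      omega
    have hmul : ∀ x y : σ →₀ ℕ, ρ (MvPolynomial.monomial (x + y) 1) =
        ρ (MvPolynomial.monomial x 1) * ρ (MvPolynomial.monomial y 1) := by
      intro x y
      rw [← map_mul, MvPolynomial.monomial_mul, one_mul]
    simp only [h, hprod, totalExponent_add_single]
    rw [hsplit v w hv hw, hsplit w v hw hv, hmul, hmul, sup_comm (χ w), mul_assoc,
      ← mul_assoc _ (β v), hβ v w]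
    ring
  -- Evaluation in `B` factors `k`-linearly through evaluation in `R[t]`: `x ^ u t ^ s` is written
  -- with any `s` generators whose product divides `x ^ u`, and `hh` makes the choice irrelevant.
  -- The value 0 elsewhere is never used.
  let H : Polynomial (MvPolynomial σ k) →ₗ[k] B :=
    ((MvPolynomial.basisMonomials σ k).smulTower
      (Polynomial.basisMonomials (MvPolynomial σ k))).constr k fun x =>
        if hx : ∃ a : V →₀ ℕ, ∑ i, a i = x.2 ∧ totalExponent χ a ≤ x.1 then
          h hx.choose (x.1 - totalExponent χ hx.choose) else 0
  have hH : ∀ (a : V →₀ ℕ) (u : σ →₀ ℕ), H (Polynomial.monomial (∑ i, a i)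
      (MvPolynomial.monomial (u + totalExponent χ a) 1)) = h a u := by
    intro a u
    have hb : Polynomial.monomial (∑ i, a i)
        (MvPolynomial.monomial (u + totalExponent χ a) (1 : k)) =
        ((MvPolynomial.basisMonomials σ k).smulTower
          (Polynomial.basisMonomials (MvPolynomial σ k))) (u + totalExponent χ a, ∑ i, a i) := by
      rw [Module.Basis.smulTower_apply]
      simp [Polynomial.smul_monomial]
    have hx : ∃ b : V →₀ ℕ, ∑ i, b i = ∑ i, a i ∧ totalExponent χ b ≤ u + totalExponent χ a :=
      ⟨a, rfl, le_add_self⟩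
    rw [hb, Module.Basis.constr_basis, dif_pos hx,
      hh _ _ a hx.choose_spec.1 hx.choose_spec.2 le_add_self, add_tsub_cancel_right]
  have key : ∀ F : MvPolynomial V (MvPolynomial σ k),
      MvPolynomial.eval₂Hom (ρ : MvPolynomial σ k →+* B) β F =
      H (MvPolynomial.eval₂Hom (Polynomial.C : MvPolynomial σ k →+* _)
      (fun i => Polynomial.monomial 1 (MvPolynomial.monomial (χ i) (1 : k))) F) := by
    intro F
    induction F using MvPolynomial.induction_on' with
    | add p q hp hq => rw [map_add, map_add, map_add, hp, hq]
    | monomial a f =>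
      induction f using MvPolynomial.induction_on' with
      | add p q hp hq => simp only [map_add, hp, hq]
      | monomial u c =>
        have hpow : ∏ i, (Polynomial.monomial 1 (MvPolynomial.monomial (χ i) (1 : k))) ^ a i =
            Polynomial.monomial (∑ i, a i) (MvPolynomial.monomial (totalExponent χ a) 1) := by
          have hs : ∀ s : Finset V,
              ∏ i ∈ s, (Polynomial.monomial 1 (MvPolynomial.monomial (χ i) (1 : k))) ^ a i =
              Polynomial.monomial (∑ i ∈ s, a i)
                (MvPolynomial.monomial (∑ i ∈ s, a i • χ i) 1) := by
            intro s
            induction s using Finset.induction_on with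
            | empty => simp
            | insert i s hi ih =>
              rw [Finset.prod_insert hi, Finset.sum_insert hi, Finset.sum_insert hi, ih,
                Polynomial.monomial_pow, MvPolynomial.monomial_pow, one_pow, one_mul,
                Polynomial.monomial_mul_monomial, MvPolynomial.monomial_mul, one_mul]
          exact hs _
        have hc : MvPolynomial.monomial u c = c • MvPolynomial.monomial u (1 : k) := by
          rw [MvPolynomial.smul_monomial, smul_eq_mul, mul_one]
        rw [MvPolynomial.coe_eval₂Hom, MvPolynomial.coe_eval₂Hom, MvPolynomial.eval₂_monomial,
          MvPolynomial.eval₂_monomial, Finsupp.prod_fintype _ _ (by simp),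
          Finsupp.prod_fintype _ _ (by simp), hpow, Polynomial.C_mul_monomial,
          hc, smul_mul_assoc, MvPolynomial.monomial_mul, one_mul, ← Polynomial.smul_monomial,
          RingHom.coe_coe, map_smul, map_smul, hH, smul_mul_assoc]
  rw [key, hF, map_zero]

theorem coe_aeval_reesDegreeOne {R V : Type*} [CommRing R] {I : Ideal R} (m : V → R)
    (hm : ∀ i, m i ∈ I) (F : MvPolynomial V R) :
    (MvPolynomial.aeval (R := R) (fun i => reesDegreeOne (m i) (hm i)) F : Polynomial R) =
      MvPolynomial.aeval (R := R) (fun i => Polynomial.monomial 1 (m i)) F :=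
  MvPolynomial.comp_aeval_apply (fun i => reesDegreeOne (m i) (hm i)) (reesAlgebra I).val F

/-- The Rees algebra is generated by the elements `m i * t`, if the `m i` generate the ideal. -/
theorem aeval_reesDegreeOne_surjective {R V : Type*} [CommRing R] {I : Ideal R} (m : V → R)
    (hm : ∀ i, m i ∈ I) (hI : Ideal.span (Set.range m) = I) :
    Function.Surjective (MvPolynomial.aeval (R := R) fun i => reesDegreeOne (m i) (hm i)) := by
  have hrange : reesAlgebra I =
      (MvPolynomial.aeval (R := R) fun i => Polynomial.monomial 1 (m i)).range := by
    rw [← adjoin_monomial_eq_reesAlgebra, ← Algebra.adjoin_range_eq_range_aeval, ← hI,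
      Ideal.span, Submodule.map_span, Algebra.adjoin_span, ← Set.range_comp]
    rfl
  rintro ⟨y, hy⟩
  have hy' := hy
  rw [hrange] at hy'
  obtain ⟨F, hF⟩ := hy'
  exact ⟨F, Subtype.ext ((coe_aeval_reesDegreeOne m hm F).trans hF)⟩

/-- An ideal generated by square-free monomials that are connected by few enough edges compatible
with divisibility is of linear type: semilinear maps on the ideal extend to its Rees algebra. -/
theorem exists_reesAlgebra_lift {k σ V κ B : Type*} [Field k] [CommRing B] [Algebra k B]
    [Fintype V] [Nonempty V] [Fintype κ]
    (χ : V → σ →₀ ℕ) (hχ : ∀ i j, χ i j ≤ 1) (e : κ → V × V)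
    (hcard : Fintype.card κ + 1 ≤ Fintype.card V)
    (he : ∀ (i j : V) (P : Set V), (∀ t, χ (e t).1 ≤ χ i ⊔ χ j → χ (e t).2 ≤ χ i ⊔ χ j →
        ((e t).1 ∈ P ↔ (e t).2 ∈ P)) → i ∈ P → j ∈ P)
    {I : Ideal (MvPolynomial σ k)}
    (hI : Ideal.span (Set.range fun i => MvPolynomial.monomial (χ i) (1 : k)) = I)
    (ρ : MvPolynomial σ k →ₐ[k] B) (l : I →+ B) (hl : ∀ (r : MvPolynomial σ k) (x : I),
      l (r • x) = ρ r * l x) :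
    ∃ ψ : reesAlgebra I →+* B,
      (∀ r, ψ (algebraMap (MvPolynomial σ k) (reesAlgebra I) r) = ρ r) ∧
      ∀ a (ha : a ∈ I), ψ (reesDegreeOne a ha) = l ⟨a, ha⟩ := by
  classical
  let m : V → MvPolynomial σ k := fun i => MvPolynomial.monomial (χ i) 1
  have hm : ∀ i, m i ∈ I := fun i => hI ▸ Ideal.subset_span ⟨i, rfl⟩
  let π : MvPolynomial V (MvPolynomial σ k) →ₐ[MvPolynomial σ k] reesAlgebra I :=
    MvPolynomial.aeval fun i => reesDegreeOne (m i) (hm i)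
  have hπval := coe_aeval_reesDegreeOne m hm
  have hπ : Function.Surjective π := aeval_reesDegreeOne_surjective m hm hI
  let θ : MvPolynomial V (MvPolynomial σ k) →+* B :=
    MvPolynomial.eval₂Hom (ρ : MvPolynomial σ k →+* B) fun i => l ⟨m i, hm i⟩
  have hker : RingHom.ker (π : MvPolynomial V (MvPolynomial σ k) →+* reesAlgebra I) ≤
      RingHom.ker θ := by
    intro F hF
    refine eval₂Hom_eq_zero_of_linear_relations χ hχ e hcard he ρ _ (fun v w => ?_) F ?_
    · rw [← hl, ← hl]
      congr 1
      apply Subtype.ext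
      simp only [m, Submodule.coe_smul, smul_eq_mul, MvPolynomial.monomial_mul,
        Finsupp.tsub_add_eq_sup_nat, sup_comm]
    · have h : π F = 0 := hF
      have := hπval F
      rw [h] at this
      exact this.symm
  let ψ := RingHom.liftOfSurjective (π : MvPolynomial V (MvPolynomial σ k) →+* reesAlgebra I) hπ
    ⟨θ, hker⟩
  have hψ : ∀ F, ψ (π F) = θ F := fun F => RingHom.liftOfRightInverse_comp_apply _ _ _ ⟨θ, hker⟩ F
  refine ⟨ψ, fun r => ?_, fun a ha => ?_⟩
  · rw [← AlgHom.commutes π, hψ]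
    exact MvPolynomial.eval₂_C _ _ _
  · obtain ⟨c, hc⟩ := (Submodule.mem_span_range_iff_exists_fun _).1 (hI.ge ha)
    change ∑ i, c i • m i = a at hc
    have h1 : reesDegreeOne a ha = π (∑ i, MvPolynomial.C (c i) * MvPolynomial.X i) := by
      apply Subtype.ext
      rw [hπval, map_sum]
      simp only [reesDegreeOne, map_mul, MvPolynomial.aeval_C, MvPolynomial.aeval_X,
        Polynomial.algebraMap_apply, Algebra.algebraMap_self, RingHom.id_apply,
        Polynomial.C_mul_monomial, ← hc, map_sum, smul_eq_mul]
    have h2 : (⟨a, ha⟩ : I) = ∑ i, c i • (⟨m i, hm i⟩ : I) := by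
      apply Subtype.ext
      simp [← hc]
    rw [h1, hψ, h2, map_sum, map_sum]
    refine Finset.sum_congr rfl fun i _ => ?_
    rw [hl, map_mul]
    simp [θ]

/-! ### Reductions -/

/-- If all linear maps from `I` to residue fields extend to the Rees algebra, then `I` has no
proper reductions. -/
theorem eq_of_isReductionOf {R : Type*} [CommRing R] {I J : Ideal R} (hfg : I.FG)
    (hlift : ∀ (n : Ideal R) (l : I →ₗ[R] R ⧸ n), ∃ ψ : reesAlgebra I →+* R ⧸ n,
      ∀ a (ha : a ∈ I), ψ (reesDegreeOne a ha) = l ⟨a, ha⟩)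
    (hJ : IsReductionOf J I) : J = I := by
  obtain ⟨hle, r, hr⟩ := hJ
  have : Module.Finite R I := Module.Finite.iff_fg.2 hfg
  rcases eq_top_or_exists_le_coatom (Submodule.comap I.subtype J) with htop | ⟨N, hN, hJN⟩
  · refine le_antisymm hle fun a ha => ?_
    have : (⟨a, ha⟩ : I) ∈ Submodule.comap I.subtype J := htop ▸ Submodule.mem_top
    exact this
  exfalso
  obtain ⟨n, hn, ⟨eq⟩⟩ := isSimpleModule_iff_quot_maximal.1 (isSimpleModule_iff_isCoatom.2 hN)
  let l : I →ₗ[R] R ⧸ n := eq.toLinearMap.comp N.mkQ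
  have hl : ∀ x : I, l x = 0 ↔ x ∈ N := fun x => by simp [l]
  obtain ⟨ψ, hψ⟩ := hlift n l
  -- `ψ` kills `J t`, hence all of `J I ^ r t ^ (r + 1) = I ^ (r + 1) t ^ (r + 1)`. But `(x t) ^ (r
  -- + 1)` maps to `l x ^ (r + 1)`, which forces `l = 0`.
  have hzero : ∀ c (hc : c ∈ I ^ (r + 1)),
      ψ ⟨Polynomial.monomial (r + 1) c, reesAlgebra.monomial_mem.2 hc⟩ = 0 := by
    intro c hc
    have hc' := hc
    rw [← hr] at hc'
    induction hc' using Submodule.mul_induction_on' with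
    | mem_mul_mem x hx y hy =>
      have h : (⟨Polynomial.monomial (r + 1) (x * y), reesAlgebra.monomial_mem.2 hc⟩ :
          reesAlgebra I) = reesDegreeOne x (hle hx) *
          ⟨Polynomial.monomial r y, reesAlgebra.monomial_mem.2 hy⟩ := by
        apply Subtype.ext
        simp [reesDegreeOne, Polynomial.monomial_mul_monomial, add_comm]
      rw [h, map_mul, hψ, (hl _).2 (hJN hx), zero_mul]
    | add x hx y hy ihx ihy =>
      have hx' : x ∈ I ^ (r + 1) := hr ▸ hx
      have hy' : y ∈ I ^ (r + 1) := hr ▸ hy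
      have h : (⟨Polynomial.monomial (r + 1) (x + y), reesAlgebra.monomial_mem.2 hc⟩ :
          reesAlgebra I) = ⟨Polynomial.monomial (r + 1) x, reesAlgebra.monomial_mem.2 hx'⟩ +
          ⟨Polynomial.monomial (r + 1) y, reesAlgebra.monomial_mem.2 hy'⟩ := by
        apply Subtype.ext
        simp
      rw [h, map_add, ihx hx', ihy hy', add_zero]
  refine hN.1 (Submodule.eq_top_iff'.2 fun x => (hl x).1 ?_)
  have h : reesDegreeOne x.1 x.2 ^ (r + 1) =
      ⟨Polynomial.monomial (r + 1) (x.1 ^ (r + 1)),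
        reesAlgebra.monomial_mem.2 (Ideal.pow_mem_pow x.2 _)⟩ := by
    apply Subtype.ext
    simp [reesDegreeOne, Polynomial.monomial_pow]
  have h0 := hzero _ (Ideal.pow_mem_pow x.2 (r + 1))
  rw [← h, map_pow, hψ] at h0
  have : IsDomain (R ⧸ n) := Ideal.Quotient.isDomain n
  exact pow_eq_zero_iff (Nat.succ_ne_zero r) |>.1 h0

/-! ### Minimal generators and the fiber cone -/

/-- The coefficients of the elements of a monomial ideal at its minimal generators. -/
noncomputable def generatorCoeffs {k σ V : Type*} [Field k] {χ : V → σ →₀ ℕ}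
    (hanti : ∀ i j, χ j ≤ χ i → j = i) {I : Ideal (MvPolynomial σ k)}
    (hI : Ideal.span (Set.range fun i => MvPolynomial.monomial (χ i) (1 : k)) = I) :
    I →ₛₗ[(MvPolynomial.constantCoeff : MvPolynomial σ k →+* k)] (V → k) where
  toFun f i := (f : MvPolynomial σ k).coeff (χ i)
  map_add' f g := by
    ext i
    simp
  map_smul' r f := by
    classical
    ext i
    simp only [Submodule.coe_smul, smul_eq_mul, Pi.smul_apply, MvPolynomial.coeff_mul]
    -- A monomial of `f` dividing the `i`-th generator is a multiple of some generator, hence equals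
    -- the `i`-th one; only the constant term of `r` contributes.
    rw [Finset.sum_eq_single_of_mem (0, χ i) (by simp), MvPolynomial.constantCoeff_eq]
    rintro ⟨a, b⟩ hab hne
    rw [Finset.HasAntidiagonal.mem_antidiagonal] at hab
    by_contra h
    have hb : b ∈ (f : MvPolynomial σ k).support :=
      MvPolynomial.mem_support_iff.2 (right_ne_zero_of_mul h)
    have hf := hI.ge f.2
    rw [Set.range_comp' (fun u => MvPolynomial.monomial u (1 : k)) χ,
      MvPolynomial.mem_ideal_span_monomial_image] at hf
    obtain ⟨_, ⟨j, rfl⟩, hj⟩ := hf b hb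
    have hbi : b ≤ χ i := hab ▸ le_add_self
    have hji := hanti i j (hj.trans hbi)
    have hbe : b = χ i := le_antisymm hbi (hji ▸ hj)
    apply hne
    rw [Prod.mk.injEq]
    refine ⟨?_, hbe⟩
    rw [hbe] at hab
    exact add_eq_right.1 hab

theorem generatorCoeffs_monomial {k σ V : Type*} [Field k] [DecidableEq V] {χ : V → σ →₀ ℕ}
    (hanti : ∀ i j, χ j ≤ χ i → j = i) {I : Ideal (MvPolynomial σ k)}
    (hI : Ideal.span (Set.range fun i => MvPolynomial.monomial (χ i) (1 : k)) = I) (i : V)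
    (h : MvPolynomial.monomial (χ i) 1 ∈ I) :
    generatorCoeffs hanti hI ⟨MvPolynomial.monomial (χ i) 1, h⟩ = Pi.single i 1 := by
  classical
  ext j
  change (MvPolynomial.monomial (χ i) (1 : k)).coeff (χ j) = _
  rw [MvPolynomial.coeff_monomial, Pi.single_apply]
  congr 1
  exact propext ⟨fun h => (hanti j i h.le).symm, fun h => h ▸ rfl⟩

/-- The minimal monomial generators of a monomial ideal form a generating set of least
cardinality. -/
theorem spanFinrank_monomial_ideal {k σ V : Type*} [Field k] [Fintype V] {χ : V → σ →₀ ℕ}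
    (hanti : ∀ i j, χ j ≤ χ i → j = i) {I : Ideal (MvPolynomial σ k)}
    (hI : Ideal.span (Set.range fun i => MvPolynomial.monomial (χ i) (1 : k)) = I) :
    I.spanFinrank = Fintype.card V := by
  classical
  apply le_antisymm
  · rw [← hI]
    refine (Submodule.spanFinrank_span_le_ncard_of_finite (Set.finite_range _)).trans ?_
    rw [← Set.image_univ, ← Nat.card_eq_fintype_card, ← Set.ncard_univ]
    exact Set.ncard_image_le Set.finite_univ
  · have hfg : I.FG := ⟨(Set.finite_range _).toFinset, by rw [Set.Finite.coe_toFinset]; exact hI⟩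
    have : RingHomSurjective (MvPolynomial.constantCoeff : MvPolynomial σ k →+* k) :=
      ⟨fun c => ⟨MvPolynomial.C c, MvPolynomial.constantCoeff_C _ c⟩⟩
    -- The lower bound: the coefficient map is semilinear over the constant term and onto `k ^ V`.
    have h := Submodule.spanFinrank_map_le_of_fg (generatorCoeffs hanti hI)
      (p := ⊤) ((Submodule.fg_top _).2 hfg)
    have htop : Submodule.map (generatorCoeffs hanti hI) ⊤ = ⊤ := by
      rw [← top_le_iff, ← (Pi.basisFun k V).span_eq, Submodule.span_le]
      rintro _ ⟨i, rfl⟩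
      rw [Pi.basisFun_apply]
      exact ⟨_, Submodule.mem_top, generatorCoeffs_monomial hanti hI i
        (hI ▸ Ideal.subset_span ⟨i, rfl⟩)⟩
    rw [htop, Submodule.spanFinrank_top, ← Module.finrank_eq_spanFinrank_of_free,
      Module.finrank_pi] at h
    exact h

/-- A polynomial minus its constant term lies in the ideal of the variables, which dies in the fiber
cone. -/
theorem mk_algebraMap_eq_algebraMap_constantCoeff {σ k : Type*} [CommRing k]
    (I : Ideal (MvPolynomial σ k)) (f : MvPolynomial σ k) :
    (Ideal.Quotient.mk _ (algebraMap (MvPolynomial σ k) (reesAlgebra I) f) : FiberCone I) =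
      algebraMap k (FiberCone I) (MvPolynomial.constantCoeff f) := by
  have h : algebraMap k (FiberCone I) (MvPolynomial.constantCoeff f) =
      Ideal.Quotient.mk _ (algebraMap (MvPolynomial σ k) (reesAlgebra I)
        (MvPolynomial.C (MvPolynomial.constantCoeff f))) := rfl
  rw [h, Ideal.Quotient.mk_eq_mk_iff_sub_mem, ← map_sub]
  apply Ideal.mem_map_of_mem
  rw [MvPolynomial.idealOfVars, ← Set.image_univ, MvPolynomial.mem_ideal_span_X_image]
  intro u hu
  by_contra! h0
  have : u = 0 := Finsupp.ext fun i => h0 i (Set.mem_univ i)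
  rw [MvPolynomial.mem_support_iff, this] at hu
  simp [MvPolynomial.constantCoeff_eq] at hu

/-- The fiber cone is generated over the base ring by the classes of the elements `m i * t`, if the
`m i` generate the ideal. -/
theorem FiberCone.aeval_degreeOne_surjective {σ k V : Type*} [CommRing k]
    {I : Ideal (MvPolynomial σ k)} (m : V → MvPolynomial σ k)
    (hI : Ideal.span (Set.range m) = I) (hm : ∀ i, m i ∈ I) :
    Function.Surjective
      (MvPolynomial.aeval (R := k) fun i => FiberCone.degreeOne (m i) (hm i)) := by
  intro y
  obtain ⟨y, rfl⟩ := Ideal.Quotient.mk_surjective y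
  obtain ⟨F, rfl⟩ := aeval_reesDegreeOne_surjective m hm hI y
  rw [← AlgHom.mem_range]
  induction F using MvPolynomial.induction_on with
  | C f =>
    rw [MvPolynomial.aeval_C, mk_algebraMap_eq_algebraMap_constantCoeff]
    exact Subalgebra.algebraMap_mem _ _
  | add p q hp hq =>
    rw [map_add, map_add]
    exact Subalgebra.add_mem _ hp hq
  | mul_X p i hp =>
    rw [map_mul, map_mul]
    refine Subalgebra.mul_mem _ hp ⟨MvPolynomial.X i, ?_⟩
    rw [MvPolynomial.aeval_X]
    exact MvPolynomial.aeval_X _ _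

/-- The only minimal reduction of an ideal without proper reductions is the ideal itself. -/
theorem analyticSpread_eq_spanFinrank {R : Type*} [CommRing R] {I : Ideal R}
    (h : ∀ J, IsReductionOf J I → J = I) : analyticSpread I = I.spanFinrank := by
  have hI : IsReductionOf I I := ⟨le_rfl, 0, by simp⟩
  have : {J : Ideal R | IsMinimalReductionOf J I} = {I} := by
    ext J
    refine ⟨fun hJ => h J hJ.1, ?_⟩
    rintro rfl
    exact ⟨hI, fun K hK _ => (h K hK).ge⟩
  rw [analyticSpread, this, Set.image_singleton, csInf_singleton]

/-- A generator divisible by another could be dropped, so minimality makes the exponents an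
antichain. -/
theorem exists_exponents_of_isMinimalGeneratingFamily {k σ V : Type*} [Field k]
    {I : Ideal (MvPolynomial σ k)} {m : V → MvPolynomial σ k}
    (hm : ∀ i, IsSquarefreeMonomial (m i)) (hI : IsMinimalGeneratingFamily I m) :
    ∃ χ : V → σ →₀ ℕ, (m = fun i => MvPolynomial.monomial (χ i) 1) ∧ (∀ i j, χ i j ≤ 1) ∧
      ∀ i j, χ j ≤ χ i → j = i := by
  classical
  choose s hs using hm
  let χ : V → σ →₀ ℕ := fun i => ∑ j ∈ s i, Finsupp.single j 1
  have hmχ : m = fun i => MvPolynomial.monomial (χ i) 1 := by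
    funext i
    rw [hs, MvPolynomial.monomial_sum_one]
    rfl
  refine ⟨χ, hmχ, fun i j => ?_, fun i j hij => ?_⟩
  · simp only [χ, Finsupp.finsetSum_apply, Finsupp.single_apply, Finset.sum_ite_eq']
    split_ifs <;> simp
  · by_contra hne
    have h : Ideal.span (m '' {x | x ≠ i}) = I := by
      refine le_antisymm (hI.1 ▸ Ideal.span_mono (Set.image_subset_range _ _)) ?_
      conv_lhs => rw [← hI.1]
      rw [Ideal.span_le]
      rintro _ ⟨x, rfl⟩
      by_cases hx : x = i
      · have hmul : m x = MvPolynomial.monomial (χ i - χ j) 1 * m j := by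
          rw [hx, hmχ]
          simp only [MvPolynomial.monomial_mul, tsub_add_cancel_of_le hij, one_mul]
        rw [hmul]
        exact Ideal.mul_mem_left _ _ (Ideal.subset_span ⟨j, hne, rfl⟩)
      · exact Ideal.subset_span ⟨x, hx, rfl⟩
    have := hI.2 _ h
    exact (this ▸ Set.mem_univ i : i ∈ {x | x ≠ i}) rfl

theorem mainTheorem8 {k : Type*} [Field k] (n q : ℕ)
    (I : Ideal (MvPolynomial (Fin n) k)) (m : Fin (q + 1) → MvPolynomial (Fin n) k)
    (hm : ∀ i, IsSquarefreeMonomial (m i))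
    (hI : IsMinimalGeneratingFamily I m)
    (hpd : projectiveDimension (ModuleCat.of (MvPolynomial (Fin n) k) I) = 1) :
    (∀ J : Ideal (MvPolynomial (Fin n) k), IsReductionOf J I → J = I) ∧
    (∃ e : MvPolynomial (Fin (q + 1)) k ≃ₐ[k] FiberCone I,
      ∀ i, e (MvPolynomial.X i) = FiberCone.degreeOne (m i) (hI.mem i)) ∧
    ringKrullDim (FiberCone I) = (q + 1 : ℕ) ∧
    I.spanFinrank = q + 1 ∧
    analyticSpread I = I.spanFinrank := by
  obtain ⟨χ, rfl, hχ, hanti⟩ := exists_exponents_of_isMinimalGeneratingFamily hm hI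
  have hspan := hI.1
  obtain ⟨κ, _, e, hcard, he⟩ :=
    exists_edges_of_projectiveDimension_le_one χ I hspan hpd.le
  have hred : ∀ J : Ideal (MvPolynomial (Fin n) k), IsReductionOf J I → J = I := by
    intro J hJ
    refine eq_of_isReductionOf (IsNoetherian.noetherian I) (fun a l => ?_) hJ
    obtain ⟨ψ, -, hψ⟩ := exists_reesAlgebra_lift χ hχ e hcard he hspan
      (Ideal.Quotient.mkₐ k a) l.toAddMonoidHom fun r x => by
        rw [LinearMap.toAddMonoidHom_coe, map_smul, Algebra.smul_def]
        rfl
    exact ⟨ψ, hψ⟩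
  have hiso : ∃ e : MvPolynomial (Fin (q + 1)) k ≃ₐ[k] FiberCone I,
      ∀ i, e (MvPolynomial.X i) = FiberCone.degreeOne _ (hI.mem i) := by
    let c := generatorCoeffs hanti hspan
    let l : I →+ MvPolynomial (Fin (q + 1)) k :=
      { toFun := fun x => ∑ i, MvPolynomial.C (c x i) * MvPolynomial.X i
        map_zero' := by simp
        map_add' := fun x y => by simp [add_mul, Finset.sum_add_distrib] }
    -- Sending all variables to 0 matches the semilinearity of the coefficients over the constant
    -- term, and makes `ψ` vanish on `𝔪 R[It]`.
    obtain ⟨ψ, hψ, hψ1⟩ := exists_reesAlgebra_lift χ hχ e hcard he hspan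
      (MvPolynomial.aeval fun _ => (0 : MvPolynomial (Fin (q + 1)) k)) l fun r x => by
        rw [MvPolynomial.aeval_zero']
        change ∑ i, MvPolynomial.C (c (r • x) i) * MvPolynomial.X i =
          _ * ∑ i, MvPolynomial.C (c x i) * MvPolynomial.X i
        rw [Finset.mul_sum, map_smulₛₗ]
        refine Finset.sum_congr rfl fun i _ => ?_
        rw [Pi.smul_apply, smul_eq_mul, map_mul, mul_assoc]
        rfl
    let ψ' : FiberCone I →+* MvPolynomial (Fin (q + 1)) k := Ideal.Quotient.lift _ ψ (by
      change _ ≤ RingHom.ker ψ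
      rw [Ideal.map_le_iff_le_comap, MvPolynomial.idealOfVars, Ideal.span_le]
      rintro _ ⟨i, rfl⟩
      change ψ _ = 0
      rw [hψ, MvPolynomial.aeval_X])
    have hsurj := FiberCone.aeval_degreeOne_surjective _ hspan hI.mem
    have hleft : Function.LeftInverse ψ'
        (MvPolynomial.aeval (R := k) fun i => FiberCone.degreeOne _ (hI.mem i)) := by
      intro F
      induction F using MvPolynomial.induction_on with
      | C a =>
        rw [MvPolynomial.aeval_C]
        change ψ (algebraMap (MvPolynomial (Fin n) k) (reesAlgebra I) (MvPolynomial.C a)) = _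
        rw [hψ, MvPolynomial.aeval_C]
        rfl
      | add p q hp hq => rw [map_add, map_add, hp, hq]
      | mul_X p i hp =>
        rw [map_mul, map_mul, hp, MvPolynomial.aeval_X]
        congr 1
        change ψ (reesDegreeOne _ (hI.mem i)) = _
        rw [hψ1]
        change ∑ j, MvPolynomial.C (c _ j) * MvPolynomial.X j = _
        rw [generatorCoeffs_monomial, Finset.sum_eq_single_of_mem i (Finset.mem_univ i)]
        · rw [Pi.single_eq_same, map_one, one_mul]
        · intro j _ hj
          rw [Pi.single_eq_of_ne hj, map_zero, zero_mul]
    exact ⟨AlgEquiv.ofBijective _ ⟨hleft.injective, hsurj⟩, fun i => MvPolynomial.aeval_X _ i⟩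
  refine ⟨hred, hiso, ?_, ?_, analyticSpread_eq_spanFinrank hred⟩
  · obtain ⟨f, -⟩ := hiso
    rw [← ringKrullDim_eq_of_ringEquiv f.toRingEquiv,
      MvPolynomial.ringKrullDim_of_isNoetherianRing, ringKrullDim_eq_zero_of_field, zero_add,
      Nat.card_eq_fintype_card, Fintype.card_fin]
  · rw [spanFinrank_monomial_ideal hanti hspan, Fintype.card_fin]
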